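/- Throughout, $\mathbb N=\{1,2,\dots\}$ and scalars are real. Let $(m_j)_{j\ge1}$, $(n_j)_{j\ge 1}$ be sequences of natural numbers with $m_1=n_1=4$, $m_{j+1}\ge m_j^2$ and $n_{j+1}\ge m_{j+1}^2(4n_j)^{\log_2 m_{j+1}}$ for all $j$. Define finite sets $\Delta_q$, $q\ge 1$, inductively: $\Delta_1=\{1\}$ and, with $\Gamma_p=\bigcup_{r\le p}\Delta_r$, \[ \begin{aligned} \Delta_{q+1}={}&\{(q+1,0,m_j,\varepsilon e^*_\eta) : 1\le j\le q+1,\ \varepsilon=\pm1,\ \eta\in\Gamma_q\}\\ &\cup\bigcup_{1\le p<q}\ \bigcup_{1\le j\le p}\{(q+1,\xi,m_j,\varepsilon e^*_\eta) : \xi\in\Delta_p,\ w(\xi)=m_j^{-1},\ \mathrm{age}(\xi)<n_j,\ \varepsilon=\pm1,\ \eta\in\Gamma_q\setminus\Gamma_p\}. \end{aligned} \] Here a node of the form $(q+1,\cdot,m_j,\cdot)$ has weight $w=m_j^{-1}$; $\mathrm{age}(q+1,0,m_j,\varepsilon e^*_\eta)=1$ and $\mathrm{age}(q+1,\xi,m_j,\varepsilon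 e^*_\eta)=\mathrm{age}(\xi)+1$; the node $1$ has no weight. Elements of $\Delta_q$ have rank $q$, and $\Gamma=\bigcup_q\Delta_q$. For $\gamma\in\Gamma$ let $e^*_\gamma\in\ell_1(\Gamma)$ be the corresponding unit vector, and put $d^*_\gamma=e^*_\gamma-c^*_\gamma$, where $c^*_1=0$, \[ c^*_\gamma=m_j^{-1}P^*_{(0,q]}\,\varepsilon e^*_\eta \ \text{ for } \gamma=(q+1,0,m_j,\varepsilon e^*_\eta),\qquad c^*_\gamma=e^*_\xi+m_j^{-1}P^*_{(p,q]}\,\varepsilon e^*_\eta\ \text{ for } \gamma=(q+1,\xi,m_j,\varepsilon e^*_\eta),\ p=\mathrm{rank}\,\xi, \] and $P^*_{(p,q]}$ is the projection with $P^*_{(p,q]}d^*_\zeta=d^*_\zeta$ if $p<\mathrm{rank}\,\zeta\le q$ and $P^*_{(p,q]}d^*_\zeta=0$ otherwise. Let $(d_\gamma)_{\gamma\in\Gamma}\subset\ell_\infty(\Gamma)$ be biorthogonal to $(d^*_\gamma)_{\gamma\in\Gamma}$. For $0\ne h\in\langle d^*_\zeta:\zeta\in\Gamma\rangle$ write $\operatorname{rng}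 h=[p,q]$ with $p$ maximal and $q$ minimal such that $h\in\langle d^*_\zeta:\mathrm{rank}\,\zeta\in[p,q]\rangle$; thus $\min\operatorname{rng}h=p$. **Proposition.** Let $\gamma\in\Gamma$ and $K,N\in\mathbb N$ with $K\le\min\operatorname{rng}e^*_\gamma\le N$. For every $i\in\mathbb N$ there exists $\gamma'\in\Gamma_{N+i}$ such that $K\le\min\operatorname{rng}e^*_{\gamma'}$ and \[ \bigl\|(e^*_\gamma-e^*_{\gamma'})\restriction\langle d_\xi:\xi\in\Gamma_N\rangle\bigr\|\le4^{-i}, \] where $e^*_\gamma$ acts on $\ell_\infty(\Gamma)$ as evaluation at $\gamma$, and the norm is that of a functional on a subspace of $\ell_\infty(\Gamma)$. -/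

import Mathlib

open scoped ENNReal

noncomputable section

namespace BmT

/-- The standing growth assumptions on the two sequences `(m_j)`, `(n_j)`, `j = 1, 2, …`
(the values at `j = 0` play no role). -/
structure Admissible (m n : ℕ → ℕ) : Prop where
  m_one : m 1 = 4
  n_one : n 1 = 4
  m_growth : ∀ j, 1 ≤ j → m j ^ 2 ≤ m (j + 1)
  n_growth : ∀ j, 1 ≤ j →
    (m (j + 1) : ℝ) ^ 2 * (4 * (n j : ℝ)) ^ Real.logb 2 (m (j + 1)) ≤ n (j + 1)

/-- Formal tuples from which the nodes are selected (see `IsNode`):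
`one` is the only node of rank one, `init q j ε η` is the tuple `(q+1, 0, m_j, ε e*_η)` and
`ext q ξ j ε η` is the tuple `(q+1, ξ, m_j, ε e*_η)`.
As `j ↦ m_j` is injective, the entry `m_j` is recorded by the index `j`. -/
inductive Node : Type
  | one : Node
  | init (q j : ℕ) (ε : ℤˣ) (η : Node) : Node
  | ext (q : ℕ) (ξ : Node) (j : ℕ) (ε : ℤˣ) (η : Node) : Node

namespace Node

def rank : Node → ℕ
  | one => 1
  | init q _ _ _ => q + 1
  | ext q _ _ _ _ => q + 1

/-- The index `j` with `w(γ) = m_j⁻¹`; the node `one` has no weight. -/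
def weightIndex : Node → Option ℕ
  | one => none
  | init _ j _ _ => some j
  | ext _ _ j _ _ => some j

/-- The age of a node (`one` has no age in the construction; the value `0` is never used). -/
def age : Node → ℕ
  | one => 0
  | init _ _ _ _ => 1
  | ext _ ξ _ _ _ => age ξ + 1

end Node

/-- `IsNode n γ` says that `γ` belongs to `Γ = ⋃_q Δ_q`, where `Δ_1 = {one}` and `Δ_{q+1}`
consists of the tuples `(q+1, 0, m_j, ε e*_η)` with `1 ≤ j ≤ q+1`, `ε = ±1`, `η ∈ Γ_q`, and of the
tuples `(q+1, ξ, m_j, ε e*_η)` with `1 ≤ p < q`, `1 ≤ j ≤ p`, `ξ ∈ Δ_p`, `w(ξ) = m_j⁻¹`,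
`age ξ < n_j`, `ε = ±1`, `η ∈ Γ_q \ Γ_p`. -/
inductive IsNode (n : ℕ → ℕ) : Node → Prop
  | one : IsNode n Node.one
  | init {q j : ℕ} {ε : ℤˣ} {η : Node} (one_le_j : 1 ≤ j) (j_le : j ≤ q + 1)
      (hη : IsNode n η) (rank_η : η.rank ≤ q) : IsNode n (Node.init q j ε η)
  | ext {q j : ℕ} {ε : ℤˣ} {ξ η : Node} (hξ : IsNode n ξ) (one_le_rank : 1 ≤ ξ.rank)
      (rank_ξ : ξ.rank < q) (one_le_j : 1 ≤ j) (j_le : j ≤ ξ.rank)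
      (weight_ξ : ξ.weightIndex = some j) (age_ξ : ξ.age < n j)
      (hη : IsNode n η) (rank_ξ_η : ξ.rank < η.rank) (rank_η : η.rank ≤ q) :
      IsNode n (Node.ext q ξ j ε η)

theorem IsNode.of_init {n : ℕ → ℕ} {q j : ℕ} {ε : ℤˣ} {η : Node}
    (h : IsNode n (Node.init q j ε η)) : IsNode n η := by
  cases h; assumption

theorem IsNode.of_ext_left {n : ℕ → ℕ} {q j : ℕ} {ε : ℤˣ} {ξ η : Node}
    (h : IsNode n (Node.ext q ξ j ε η)) : IsNode n ξ := by
  cases h; assumption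

theorem IsNode.of_ext_right {n : ℕ → ℕ} {q j : ℕ} {ε : ℤˣ} {ξ η : Node}
    (h : IsNode n (Node.ext q ξ j ε η)) : IsNode n η := by
  cases h; assumption

/-- The set `Γ` of all nodes. -/
abbrev Gam (n : ℕ → ℕ) : Type := {γ : Node // IsNode n γ}

/-- `Γ_N`, the set of nodes of rank at most `N`. -/
def GamLE (n : ℕ → ℕ) (N : ℕ) : Set (Gam n) := {γ | γ.1.rank ≤ N}

/-- `e*_γ`, the unit vectors of `c_00(Γ) ⊆ ℓ_1(Γ)`. -/
def eStar {n : ℕ → ℕ} (γ : Gam n) : Gam n →₀ ℝ := Finsupp.single γ 1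

/-- The signed weight `ε m_j⁻¹`. -/
def sw (m : ℕ → ℕ) (j : ℕ) (ε : ℤˣ) : ℝ := ((ε : ℤ) : ℝ) * (m j : ℝ)⁻¹

/-- `projE m γ hγ p q` is `P*_{(p,q]} e*_γ`, computed by recursion from
`e*_γ = d*_γ + c*_γ` and from the fact that `P*_{(p,q]}` keeps the vectors `d*_ξ` with
`rank ξ ∈ (p,q]` and annihilates the others. That these vectors are the values of the
projection attached to `(d*_ξ)` is proved in `PStar_dStar`. -/
def projE (m : ℕ → ℕ) {n : ℕ → ℕ} : (γ : Node) → IsNode n γ → ℕ → ℕ → (Gam n →₀ ℝ)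
  | .one, h, p, q => if p < 1 ∧ 1 ≤ q then eStar ⟨.one, h⟩ else 0
  | .init r j ε η, h, p, q =>
      (if p < r + 1 ∧ r + 1 ≤ q then
        eStar ⟨.init r j ε η, h⟩ - sw m j ε • projE m η h.of_init 0 r else 0)
      + sw m j ε • projE m η h.of_init p (min q r)
  | .ext r ξ j ε η, h, p, q =>
      (if p < r + 1 ∧ r + 1 ≤ q then
        eStar ⟨.ext r ξ j ε η, h⟩
          - (eStar ⟨ξ, h.of_ext_left⟩ + sw m j ε • projE m η h.of_ext_right ξ.rank r) else 0)
      + (projE m ξ h.of_ext_left p q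
        + sw m j ε • projE m η h.of_ext_right (max p ξ.rank) (min q r))

/-- The projection `P*_{(p,q]}` of `c_00(Γ)` onto `⟨d*_γ : rank γ ∈ (p,q]⟩`. -/
def PStar (m n : ℕ → ℕ) (p q : ℕ) : (Gam n →₀ ℝ) →ₗ[ℝ] (Gam n →₀ ℝ) :=
  Finsupp.linearCombination ℝ fun γ : Gam n => projE m γ.1 γ.2 p q

/-- `c*_γ`: it is `m_j⁻¹ P*_{(0,q]} (ε e*_η)` for `γ = (q+1, 0, m_j, ε e*_η)` and
`e*_ξ + m_j⁻¹ P*_{(rank ξ, q]} (ε e*_η)` for `γ = (q+1, ξ, m_j, ε e*_η)`. -/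
def cStar (m : ℕ → ℕ) {n : ℕ → ℕ} : Gam n → (Gam n →₀ ℝ)
  | ⟨.one, _⟩ => 0
  | ⟨.init q j ε η, h⟩ =>
      (m j : ℝ)⁻¹ • PStar m n 0 q (((ε : ℤ) : ℝ) • eStar ⟨η, h.of_init⟩)
  | ⟨.ext q ξ j ε η, h⟩ =>
      eStar ⟨ξ, h.of_ext_left⟩
        + (m j : ℝ)⁻¹ • PStar m n ξ.rank q (((ε : ℤ) : ℝ) • eStar ⟨η, h.of_ext_right⟩)

/-- `d*_γ = e*_γ - c*_γ`. -/
def dStar (m : ℕ → ℕ) {n : ℕ → ℕ} (γ : Gam n) : Gam n →₀ ℝ := eStar γ - cStar m γ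

theorem PStar_eStar (m : ℕ → ℕ) {n : ℕ → ℕ} (p q : ℕ) (γ : Gam n) :
    PStar m n p q (eStar γ) = projE m γ.1 γ.2 p q := by
  simp [PStar, eStar]

theorem dStar_one (m : ℕ → ℕ) {n : ℕ → ℕ} (h : IsNode n Node.one) :
    dStar m ⟨.one, h⟩ = eStar ⟨.one, h⟩ := by
  simp [dStar, cStar]

theorem dStar_init (m : ℕ → ℕ) {n : ℕ → ℕ} {q j : ℕ} {ε : ℤˣ} {η : Node}
    (h : IsNode n (Node.init q j ε η)) :
    dStar m ⟨_, h⟩ = eStar ⟨_, h⟩ - sw m j ε • projE m η h.of_init 0 q := by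
  simp [dStar, cStar, PStar_eStar, sw, smul_smul, mul_comm]

theorem dStar_ext (m : ℕ → ℕ) {n : ℕ → ℕ} {q j : ℕ} {ε : ℤˣ} {ξ η : Node}
    (h : IsNode n (Node.ext q ξ j ε η)) :
    dStar m ⟨_, h⟩ = eStar ⟨_, h⟩
      - (eStar ⟨ξ, h.of_ext_left⟩ + sw m j ε • projE m η h.of_ext_right ξ.rank q) := by
  simp [dStar, cStar, PStar_eStar, sw, smul_smul, mul_comm]

theorem PStar_projE (m : ℕ → ℕ) {n : ℕ → ℕ} (γ : Node) (h : IsNode n γ) (p q p' q' : ℕ) :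
    PStar m n p q (projE m γ h p' q') = projE m γ h (max p p') (min q q') := by
  induction γ generalizing p q p' q' with
  | one =>
    simp only [projE, apply_ite (PStar m n p q), PStar_eStar, map_zero]
    split_ifs <;> first | rfl | omega
  | init r j ε η ih =>
    simp only [projE, apply_ite (PStar m n p q), PStar_eStar, map_zero, map_add, map_sub,
      map_smul, ih]
    have h1 : max p 0 = p := by omega
    have h2 : min (min q q') r = min q (min q' r) := by omega
    simp only [h1, h2]
    split_ifs <;> first | omega | simp
  | ext r ξ j ε η ih1 ih2 =>
    simp only [projE, apply_ite (PStar m n p q), PStar_eStar, map_zero, map_add, map_sub,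
      map_smul, ih1, ih2]
    have h1 : max (max p p') ξ.rank = max p (max p' ξ.rank) := by omega
    have h2 : min (min q q') r = min q (min q' r) := by omega
    simp only [h1, h2]
    split_ifs <;> first | omega | simp

/-- `P*_{(p,q]}` is the projection attached to the system `(d*_γ)`. -/
theorem PStar_dStar (m : ℕ → ℕ) {n : ℕ → ℕ} (p q : ℕ) (γ : Gam n) :
    PStar m n p q (dStar m γ) =
      if p < γ.1.rank ∧ γ.1.rank ≤ q then dStar m γ else 0 := by
  obtain ⟨γ, h⟩ := γ
  cases γ with
  | one => simp only [dStar_one, PStar_eStar, projE, Node.rank]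
  | init r j ε η =>
    simp only [dStar_init, map_sub, map_smul, PStar_eStar, PStar_projE, projE, Node.rank]
    simp
  | ext r ξ j ε η =>
    simp only [dStar_ext, map_sub, map_add, map_smul, PStar_eStar, PStar_projE, projE, Node.rank]
    simp

theorem projE_zero_eq (m : ℕ → ℕ) {n : ℕ → ℕ} (γ : Node) (h : IsNode n γ) (q : ℕ)
    (hq : γ.rank ≤ q) : projE m γ h 0 q = eStar ⟨γ, h⟩ := by
  induction γ generalizing q with
  | one => simp only [Node.rank] at hq; simp [projE]; omega
  | init r j ε η ih =>
    simp only [Node.rank] at hq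
    have h1 : min q r = r := by omega
    simp [projE, h1, hq]
  | ext r ξ j ε η ih1 ih2 =>
    simp only [Node.rank] at hq
    have h1 : min q r = r := by omega
    have h3 : ξ.rank ≤ q := by cases h; omega
    simp [projE, h1, hq, ih1 h.of_ext_left q h3]

theorem projE_mem_span (m : ℕ → ℕ) {n : ℕ → ℕ} (γ : Node) (h : IsNode n γ) (p q : ℕ) :
    projE m γ h p q ∈
      Submodule.span ℝ (dStar m '' {ξ : Gam n | p < ξ.1.rank ∧ ξ.1.rank ≤ q}) := by
  induction γ generalizing p q with
  | one =>
    simp only [projE, ← dStar_one m h]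
    split_ifs with hc
    · exact Submodule.subset_span ⟨_, hc, rfl⟩
    · exact zero_mem _
  | init r j ε η ih =>
    simp only [projE, ← dStar_init m h]
    refine add_mem ?_ (Submodule.smul_mem _ _
      (Submodule.span_mono (Set.image_mono ?_) (ih h.of_init p (min q r))))
    · split_ifs with hc
      · exact Submodule.subset_span ⟨_, hc, rfl⟩
      · exact zero_mem _
    · intro ξ hξ; simp only [Set.mem_ofPred_eq] at hξ ⊢; omega
  | ext r ξ j ε η ih1 ih2 =>
    simp only [projE, ← dStar_ext m h]
    refine add_mem ?_ (add_mem (ih1 h.of_ext_left p q) (Submodule.smul_mem _ _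
      (Submodule.span_mono (Set.image_mono ?_)
        (ih2 h.of_ext_right (max p ξ.rank) (min q r)))))
    · split_ifs with hc
      · exact Submodule.subset_span ⟨_, hc, rfl⟩
      · exact zero_mem _
    · intro ξ hξ; simp only [Set.mem_ofPred_eq] at hξ ⊢; omega

/-- For `h ∈ ⟨d*_ξ : ξ ∈ Γ⟩`, the left end point `min rng h` of the interval `rng h = [p,q]`:
the maximal `p` such that `h ∈ ⟨d*_ξ : rank ξ ∈ [p,q]⟩` for some `q`. -/
def minRng (m : ℕ → ℕ) {n : ℕ → ℕ} (h : Gam n →₀ ℝ) : ℕ :=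
  sSup {p : ℕ | ∃ q : ℕ,
    h ∈ Submodule.span ℝ (dStar m '' {ξ : Gam n | ξ.1.rank ∈ Set.Icc p q})}

/-- For `h = e*_γ` the maximum in the definition of `minRng` is attained. -/
theorem isGreatest_minRng (m : ℕ → ℕ) {n : ℕ → ℕ} (γ : Gam n) :
    IsGreatest {p : ℕ | ∃ q : ℕ,
      eStar γ ∈ Submodule.span ℝ (dStar m '' {ξ : Gam n | ξ.1.rank ∈ Set.Icc p q})}
      (minRng m (eStar γ)) := by
  have hb : ∀ p ∈ {p : ℕ | ∃ q : ℕ,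
      eStar γ ∈ Submodule.span ℝ (dStar m '' {ξ : Gam n | ξ.1.rank ∈ Set.Icc p q})},
      p ≤ γ.1.rank := by
    rintro p ⟨q, hq⟩
    by_contra hlt
    have h0 : PStar m n 0 γ.1.rank (eStar γ) = eStar γ := by
      rw [PStar_eStar, projE_zero_eq _ _ _ _ le_rfl]
    have h1 : PStar m n 0 γ.1.rank (eStar γ) = 0 := by
      refine Submodule.span_induction (p := fun x _ => PStar m n 0 γ.1.rank x = 0)
        ?_ (map_zero _) ?_ ?_ hq
      · rintro _ ⟨ξ, hξ, rfl⟩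
        rw [PStar_dStar, if_neg]
        have := hξ.1
        omega
      · intro x y _ _ hx hy; rw [map_add, hx, hy, add_zero]
      · intro a x _ hx; rw [map_smul, hx, smul_zero]
    rw [h0] at h1
    simp [eStar] at h1
  refine ⟨Nat.sSup_mem ⟨0, γ.1.rank, ?_⟩ ⟨γ.1.rank, hb⟩, fun p hp => le_csSup ⟨γ.1.rank, hb⟩ hp⟩
  rw [← projE_zero_eq m γ.1 γ.2 _ le_rfl]
  refine Submodule.span_mono (Set.image_mono ?_) (projE_mem_span m γ.1 γ.2 0 γ.1.rank)
  intro ξ hξ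
  exact ⟨Nat.zero_le _, hξ.2⟩

open Classical in
/-- `dVal m ξ γ` is the value `d_ξ(γ)`, the coefficient at `d*_ξ` of `e*_γ = d*_γ + c*_γ`,
computed by recursion. -/
def dVal (m : ℕ → ℕ) (ξ : Node) : Node → ℝ
  | .one => if ξ = .one then 1 else 0
  | .init q j ε η =>
      (if ξ = .init q j ε η then 1 else 0)
        + sw m j ε * (if 0 < ξ.rank ∧ ξ.rank ≤ q then dVal m ξ η else 0)
  | .ext q ζ j ε η =>
      (if ξ = .ext q ζ j ε η then 1 else 0)
        + (dVal m ξ ζ + sw m j ε * (if ζ.rank < ξ.rank ∧ ξ.rank ≤ q then dVal m ξ η else 0))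

theorem dVal_eq_zero (m : ℕ → ℕ) {n : ℕ → ℕ} (ξ γ : Node) (h : IsNode n γ)
    (hr : γ.rank < ξ.rank) : dVal m ξ γ = 0 := by
  induction γ with
  | one =>
    rw [dVal, if_neg]
    rintro rfl; omega
  | init q j ε η ih =>
    have h1 : ξ ≠ .init q j ε η := by rintro rfl; omega
    change q + 1 < ξ.rank at hr
    have h2 : ¬ (0 < ξ.rank ∧ ξ.rank ≤ q) := by omega
    simp [dVal, h1, h2]
  | ext q ζ j ε η ih1 ih2 =>
    have h1 : ξ ≠ .ext q ζ j ε η := by rintro rfl; omega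
    change q + 1 < ξ.rank at hr
    have h2 : ¬ (ζ.rank < ξ.rank ∧ ξ.rank ≤ q) := by omega
    have h3 : ζ.rank < q := by cases h; assumption
    rw [dVal, if_neg h1, if_neg h2, ih1 h.of_ext_left (by omega)]; simp

theorem Admissible.four_le {m n : ℕ → ℕ} (h : Admissible m n) {j : ℕ} (hj : 1 ≤ j) : 4 ≤ m j := by
  induction j, hj using Nat.le_induction with
  | base => exact h.m_one.ge
  | succ j hj ih => have := h.m_growth j hj; nlinarith

theorem Admissible.abs_sw_le {m n : ℕ → ℕ} (h : Admissible m n) {j : ℕ} (hj : 1 ≤ j) (ε : ℤˣ) :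
    |sw m j ε| ≤ 1 := by
  have h4 : (1 : ℝ) ≤ m j := by exact_mod_cast (by have := h.four_le hj; omega : 1 ≤ m j)
  have : |(m j : ℝ)⁻¹| ≤ 1 := by
    rw [abs_of_nonneg (by positivity)]; exact inv_le_one_of_one_le₀ h4
  rcases Int.units_eq_one_or ε with rfl | rfl <;> simpa [sw] using this

theorem abs_dVal_le_one {m n : ℕ → ℕ} (hmn : Admissible m n) (ξ γ : Node) (h : IsNode n γ) :
    |dVal m ξ γ| ≤ 1 := by
  induction γ with
  | one => rw [dVal]; split_ifs <;> simp
  | init q j ε η ih =>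
    have hj : 1 ≤ j := by cases h; assumption
    rw [dVal]
    by_cases h1 : ξ = .init q j ε η
    · have h2 : ¬ (0 < ξ.rank ∧ ξ.rank ≤ q) := by simp [h1, Node.rank]
      rw [if_pos h1, if_neg h2]; simp
    · rw [if_neg h1, zero_add, abs_mul]
      refine mul_le_one₀ (hmn.abs_sw_le hj ε) (abs_nonneg _) ?_
      split_ifs
      · exact ih h.of_init
      · simp
  | ext q ζ j ε η ih1 ih2 =>
    have hj : 1 ≤ j := by cases h; assumption
    have h3 : ζ.rank < q := by cases h; assumption
    rw [dVal]
    by_cases h1 : ξ = .ext q ζ j ε η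
    · have hr : ξ.rank = q + 1 := by rw [h1]; rfl
      rw [if_pos h1, if_neg (by omega), dVal_eq_zero m ξ ζ h.of_ext_left (by omega)]; simp
    · rw [if_neg h1, zero_add]
      by_cases h2 : ζ.rank < ξ.rank
      · rw [dVal_eq_zero m ξ ζ h.of_ext_left h2, zero_add, abs_mul]
        refine mul_le_one₀ (hmn.abs_sw_le hj ε) (abs_nonneg _) ?_
        split_ifs
        · exact ih2 h.of_ext_right
        · simp
      · rw [if_neg (by omega), mul_zero, add_zero]
        exact ih1 h.of_ext_left

/-- The space `ℓ_∞(Γ)`. -/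
abbrev LInf (n : ℕ → ℕ) : Type := lp (fun _ : Gam n => ℝ) ∞

/-- The vectors `d_ξ ∈ ℓ_∞(Γ)`, biorthogonal to `(d*_γ)` by `pairing_dStar_d`. -/
def d {m n : ℕ → ℕ} (hmn : Admissible m n) (ξ : Gam n) : LInf n :=
  ⟨fun γ => dVal m ξ.1 γ.1, memℓp_infty ⟨1, by
    rintro _ ⟨γ, rfl⟩
    exact abs_dVal_le_one hmn ξ.1 γ.1 γ.2⟩⟩

/-- The evaluation functional `x ↦ x(γ)` on `ℓ_∞(Γ)`. -/
def evalAt {n : ℕ → ℕ} (γ : Gam n) : LInf n →L[ℝ] ℝ :=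
  lp.evalCLM ℝ (fun _ : Gam n => ℝ) ∞ γ

/-- The duality: `h = ∑ h_γ e*_γ` acts on `ℓ_∞(Γ)` by `x ↦ ∑ h_γ x(γ)`. -/
def pairing (n : ℕ → ℕ) : (Gam n →₀ ℝ) →ₗ[ℝ] (LInf n →L[ℝ] ℝ) :=
  Finsupp.linearCombination ℝ fun γ : Gam n => evalAt γ

theorem pairing_eStar {n : ℕ → ℕ} (γ : Gam n) (x : LInf n) : pairing n (eStar γ) x = x γ := by
  simp only [pairing, eStar, Finsupp.linearCombination_single, one_smul]
  rfl

theorem pairing_projE {m n : ℕ → ℕ} (hmn : Admissible m n) (ξ : Gam n) (γ : Node)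
    (h : IsNode n γ) (p q : ℕ) :
    pairing n (projE m γ h p q) (d hmn ξ) =
      if p < ξ.1.rank ∧ ξ.1.rank ≤ q then dVal m ξ.1 γ else 0 := by
  have he : ∀ γ : Gam n, pairing n (eStar γ) (d hmn ξ) = dVal m ξ.1 γ.1 := fun γ =>
    pairing_eStar γ _
  induction γ generalizing p q with
  | one =>
    by_cases h1 : ξ.1 = .one
    · rw [projE, apply_ite (pairing n)]
      simp only [h1, Node.rank]
      split_ifs <;> simp [he, h1]
    · rw [projE, apply_ite (pairing n)]
      split_ifs <;> simp [he, h1, dVal]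
  | init r j ε η ih =>
    rw [projE, apply_ite (fun v => v + _)]
    by_cases h1 : ξ.1 = .init r j ε η
    · have hr : ξ.1.rank = r + 1 := by rw [h1]; rfl
      simp only [hr, apply_ite (pairing n), map_add, map_sub, map_smul, zero_add]
      split_ifs <;> simp [he, ih, hr]
    · split_ifs <;> simp [he, ih, dVal, h1] <;> grind
  | ext r ζ j ε η ih1 ih2 =>
    rw [projE, apply_ite (fun v => v + _)]
    by_cases h1 : ξ.1 = .ext r ζ j ε η
    · have hr : ξ.1.rank = r + 1 := by rw [h1]; rfl
      have h3 : ζ.rank < r := by cases h; assumption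
      have hz := dVal_eq_zero m ξ.1 ζ h.of_ext_left (by omega)
      split_ifs <;> simp [he, ih1, ih2, hr, hz] <;> omega
    · split_ifs <;> simp [he, ih1, ih2, dVal, h1] <;> grind

open Classical in
/-- Biorthogonality of `(d_ξ)` and `(d*_γ)`. -/
theorem pairing_dStar_d {m n : ℕ → ℕ} (hmn : Admissible m n) (γ ξ : Gam n) :
    pairing n (dStar m γ) (d hmn ξ) = if γ = ξ then 1 else 0 := by
  have he : ∀ γ : Gam n, pairing n (eStar γ) (d hmn ξ) = dVal m ξ.1 γ.1 := fun γ =>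
    pairing_eStar γ _
  obtain ⟨γ, h⟩ := γ
  have hiff : ((⟨γ, h⟩ : Gam n) = ξ) ↔ ξ.1 = γ := by
    rw [Subtype.ext_iff]; exact eq_comm
  simp only [hiff]
  cases γ with
  | one => simp [dStar_one, he, dVal]
  | init r j ε η => simp [dStar_init, he, pairing_projE, dVal]
  | ext r ζ j ε η => simp [dStar_ext, he, pairing_projE, dVal]

end BmT

end

open scoped ENNReal

noncomputable section

namespace BmT

/-! ### Size of the weights -/

section Nodes

variable {m n : ℕ → ℕ}

/-! The range condition is automatic: `d_one` never vanishes at a node, so every `e*_γ` has range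
starting at 1 (`minRng_eStar`).

On `⟨d_ξ : ξ ∈ Γ_N⟩` the functional `e*_γ` agrees with `P*_{(0,N]} e*_γ`, which unwinds through the
evaluation analysis of `γ`. If `γ` has rank above `N + i` and top entry `η`, then `η` enters with a
factor `m_j⁻¹ ≤ 1/4`. Replacing `η` by some `η'` of rank at most `N + i - 1`, accurate to
`4^{-(i-1)}`, and rebuilding the node at rank `N + i` therefore gives accuracy `4^{-i}`. This
suggests a structural induction on `γ` for all `i` at once (`exists_approxBy`).

Three points need care. An extension node sees `η` only through `P*_{(rank ξ, ·]}`, so the induction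
must approximate all the `P*_{(s,N]} e*_γ` simultaneously; this is what `ApproxBy` records. If `j >
N + i`, weight `m_j⁻¹` is not allowed at rank `N + i`, but then `γ` acts as a functional so small
that a fixed node of tiny weight replaces it (`exists_approxBy_of_small`). Finally, the induction
has no step `i = 0`; its place is taken by the dichotomy `exists_approxBy_one`. The constants rest
on `P*_{(0,s]}` having norm at most 2, so that `P*_{(s,N]}` has norm at most 3 on the span. -/

theorem IsNode.one_le_rank {γ : Node} (h : IsNode n γ) : 1 ≤ γ.rank := by
  cases h <;> simp [Node.rank]

theorem Admissible.four_pow_le (hmn : Admissible m n) {j : ℕ} (hj : 1 ≤ j) :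
    4 ^ j ≤ m j := by
  induction j, hj using Nat.le_induction with
  | base => simp [hmn.m_one]
  | succ j hj ih =>
    have h1 := hmn.m_growth j hj
    have h2 := hmn.four_le hj
    rw [pow_succ]
    nlinarith

theorem abs_sw (m : ℕ → ℕ) (j : ℕ) (ε : ℤˣ) : |sw m j ε| = (m j : ℝ)⁻¹ := by
  rcases Int.units_eq_one_or ε with rfl | rfl <;> simp [sw]

theorem Admissible.abs_sw_le_pow (hmn : Admissible m n) {j k : ℕ} (hj : 1 ≤ j) (hk : k ≤ j)
    (ε : ℤˣ) : |sw m j ε| ≤ ((4 : ℝ) ^ k)⁻¹ := by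
  rw [abs_sw]
  refine inv_anti₀ (by positivity) ?_
  calc (4 : ℝ) ^ k ≤ 4 ^ j := pow_le_pow_right₀ (by norm_num) hk
    _ ≤ m j := by exact_mod_cast hmn.four_pow_le hj

theorem Admissible.abs_sw_le_quarter (hmn : Admissible m n) {j : ℕ} (hj : 1 ≤ j) (ε : ℤˣ) :
    |sw m j ε| ≤ 1 / 4 := by
  simpa using hmn.abs_sw_le_pow hj hj ε

theorem Admissible.sw_ne_zero (hmn : Admissible m n) {j : ℕ} (hj : 1 ≤ j) (ε : ℤˣ) :
    sw m j ε ≠ 0 := by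
  have h4 := hmn.four_le hj
  rw [← abs_pos, abs_sw, inv_pos]
  exact_mod_cast (by omega : 0 < m j)

end Nodes

/-! ### Every range starts at 1 -/

section MinRng

variable {m n : ℕ → ℕ}

/-- Down the recursion the value at the node `one` is only multiplied by nonzero weights; in an
extension node the term of `η` is cut off above `rank ξ ≥ 1` and contributes nothing. -/
theorem dVal_one_ne_zero (hmn : Admissible m n) (γ : Node) (h : IsNode n γ) :
    dVal m .one γ ≠ 0 := by
  induction γ with
  | one => simp [dVal]
  | init q j ε η ih =>
    have hj : 1 ≤ j := by cases h; assumption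
    have hq : 1 ≤ q := by
      have := h.of_init.one_le_rank
      cases h; omega
    simpa [dVal, Node.rank, hq] using ⟨hmn.sw_ne_zero hj ε, ih h.of_init⟩
  | ext q ζ j ε η ih1 ih2 =>
    have := h.of_ext_left.one_le_rank
    have h1 : ¬ (ζ.rank < Node.one.rank ∧ Node.one.rank ≤ q) := fun h2 => by
      have : ζ.rank < 1 := h2.1
      omega
    simpa [dVal, h1] using ih1 h.of_ext_left

theorem minRng_eStar (hmn : Admissible m n) (γ : Gam n) : minRng m (eStar γ) = 1 := by
  refine (isGreatest_minRng m γ).unique ?_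
  refine ⟨⟨γ.1.rank, ?_⟩, ?_⟩
  · rw [← projE_zero_eq m γ.1 γ.2 _ le_rfl]
    refine Submodule.span_mono (Set.image_mono ?_) (projE_mem_span m γ.1 γ.2 0 γ.1.rank)
    intro ξ hξ
    exact ⟨hξ.1, hξ.2⟩
  · rintro p ⟨q, hq⟩
    by_contra! hp
    -- All `d*_ξ` of rank at least `p > 1` annihilate `d_one`, whereas `e*_γ` does not.
    have h0 : pairing n (eStar γ) (d hmn ⟨.one, .one⟩) = 0 := by
      refine Submodule.span_induction
        (p := fun x _ => pairing n x (d hmn ⟨.one, .one⟩) = 0) ?_ (by simp) ?_ ?_ hq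
      · rintro _ ⟨ξ, hξ, rfl⟩
        rw [pairing_dStar_d, if_neg]
        rintro rfl
        have : p ≤ 1 := hξ.1
        omega
      · intro x y _ _ hx hy; simp [hx, hy]
      · intro a x _ hx; simp [hx]
    rw [pairing_eStar] at h0
    exact dVal_one_ne_zero hmn γ.1 γ.2 h0

end MinRng

/-! ### Algebra and norm bounds of the projections -/

section Projections

variable {m n : ℕ → ℕ}

/-- Reduces all interval projections to initial ones; the `max` makes the formula give 0 on an empty
interval. -/
theorem projE_eq_sub (m : ℕ → ℕ) (γ : Node) (h : IsNode n γ) (p q : ℕ) :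
    projE m γ h p q = projE m γ h 0 (max p q) - projE m γ h 0 p := by
  induction γ generalizing p q with
  | one =>
    simp only [projE]
    split_ifs <;> first | omega | simp
  | init r j ε η ih =>
    simp only [projE]
    rw [ih h.of_init p (min q r)]
    rcases le_total p r with hp | hp
    · have e1 : max p (min q r) = min (max p q) r := by grind
      rw [e1, min_eq_left hp]
      split_ifs <;> first | omega | (simp [smul_sub]; try abel)
    · have e1 : max p (min q r) = p := by grind
      have e2 : min (max p q) r = r := by omega
      rw [e1, e2, min_eq_right hp]
      split_ifs <;> first | omega | simp
  | ext r ξ j ε η ih1 ih2 =>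
    have hξ : ξ.rank < r := by cases h; assumption
    simp only [projE]
    rw [ih1 h.of_ext_left p q, ih2 h.of_ext_right (max p ξ.rank) (min q r),
      ih2 h.of_ext_right (max 0 ξ.rank) (min (max p q) r),
      ih2 h.of_ext_right (max 0 ξ.rank) (min p r), ih2 h.of_ext_right ξ.rank r]
    have e0 : max 0 ξ.rank = ξ.rank := by omega
    rw [e0]
    rcases le_total p r with hp | hp
    · have e1 : max (max p ξ.rank) (min q r) = max ξ.rank (min (max p q) r) := by omega
      have e2 : max ξ.rank (min p r) = max p ξ.rank := by omega
      rw [e1, e2]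
      split_ifs <;> first | omega | (simp [smul_sub]; try abel)
    · have e1 : max (max p ξ.rank) (min q r) = max p ξ.rank := by omega
      have e2 : max ξ.rank (min (max p q) r) = max ξ.rank (min p r) := by omega
      rw [e1, e2]
      split_ifs <;> first | omega | (simp [smul_sub]; try abel)

theorem projE_eq_zero_of_le (m : ℕ → ℕ) (γ : Node) (h : IsNode n γ) {p q : ℕ} (hpq : q ≤ p) :
    projE m γ h p q = 0 := by
  rw [projE_eq_sub, max_eq_left hpq, sub_self]

theorem projE_eq_zero_of_rank_le (m : ℕ → ℕ) (γ : Node) (h : IsNode n γ) {p : ℕ} (q : ℕ)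
    (hp : γ.rank ≤ p) : projE m γ h p q = 0 := by
  rw [projE_eq_sub, projE_zero_eq m γ h _ hp, projE_zero_eq m γ h _ (hp.trans (le_max_left _ _)),
    sub_self]

theorem projE_init (m : ℕ → ℕ) {r j : ℕ} {ε : ℤˣ} {η : Node} (h : IsNode n (.init r j ε η))
    (p : ℕ) {q : ℕ} (hq : q ≤ r) :
    projE m _ h p q = sw m j ε • projE m η h.of_init p q := by
  have : ¬ (p < r + 1 ∧ r + 1 ≤ q) := by omega
  rw [projE, if_neg this, zero_add, min_eq_left hq]

theorem projE_ext (m : ℕ → ℕ) {r j : ℕ} {ε : ℤˣ} {ξ η : Node} (h : IsNode n (.ext r ξ j ε η))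
    (p : ℕ) {q : ℕ} (hq : q ≤ r) :
    projE m _ h p q = projE m ξ h.of_ext_left p q
      + sw m j ε • projE m η h.of_ext_right (max p ξ.rank) q := by
  have : ¬ (p < r + 1 ∧ r + 1 ≤ q) := by omega
  rw [projE, if_neg this, zero_add, min_eq_left hq]

theorem abs_pairing_eStar_le (γ : Gam n) (x : LInf n) : |pairing n (eStar γ) x| ≤ ‖x‖ := by
  rw [pairing_eStar]
  exact lp.norm_apply_le_norm ENNReal.top_ne_zero x γ

/-- The projections `P*_{(0,s]}` have norm at most two. -/
theorem abs_pairing_projE_zero_le (hmn : Admissible m n) (x : LInf n) (γ : Node)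
    (h : IsNode n γ) (s : ℕ) : |pairing n (projE m γ h 0 s) x| ≤ 2 * ‖x‖ := by
  have hx := norm_nonneg x
  induction γ generalizing s with
  | one =>
    by_cases hs : 1 ≤ s
    · rw [projE_zero_eq m _ h s hs]
      linarith [abs_pairing_eStar_le ⟨_, h⟩ x]
    · rw [projE_eq_zero_of_le m _ h (by omega)]
      simp
  | init r j ε η ih =>
    have hj : 1 ≤ j := by cases h; assumption
    by_cases hs : r + 1 ≤ s
    · rw [projE_zero_eq m _ h s hs]
      linarith [abs_pairing_eStar_le ⟨_, h⟩ x]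
    · rw [projE_init m h 0 (by omega)]
      simp only [map_smul, smul_apply, smul_eq_mul, abs_mul]
      nlinarith [mul_le_mul (hmn.abs_sw_le_quarter hj ε) (ih h.of_init s) (abs_nonneg _)
        (by norm_num)]
  | ext r ξ j ε η ih1 ih2 =>
    have hj : 1 ≤ j := by cases h; assumption
    by_cases hs : r + 1 ≤ s
    · rw [projE_zero_eq m _ h s hs]
      linarith [abs_pairing_eStar_le ⟨_, h⟩ x]
    rw [projE_ext m h 0 (by omega), Nat.zero_max]
    rcases le_total s ξ.rank with hξ | hξ
    · rw [projE_eq_zero_of_le m η _ hξ, smul_zero, add_zero]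
      exact ih1 h.of_ext_left s
    -- This case fixes the constant: `1 + (1/4)(2 + 2) = 2`.
    · rw [projE_zero_eq m ξ _ s hξ, projE_eq_sub m η, max_eq_right hξ]
      simp only [map_add, map_sub, map_smul, add_apply,
        sub_apply, smul_apply, smul_eq_mul]
      have h1 := abs_pairing_eStar_le ⟨ξ, h.of_ext_left⟩ x
      have h2 := abs_sub (pairing n (projE m η h.of_ext_right 0 s) x)
        (pairing n (projE m η h.of_ext_right 0 ξ.rank) x)
      have h3 := ih2 h.of_ext_right s
      have h4 := ih2 h.of_ext_right ξ.rank
      refine (abs_add_le _ _).trans ?_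
      rw [abs_mul]
      have h5 := mul_le_mul (hmn.abs_sw_le_quarter hj ε)
        (h2.trans (add_le_add h3 h4)) (abs_nonneg _) (by norm_num)
      linarith

theorem pairing_projE_zero_eq (hmn : Admissible m n) {N : ℕ} {x : LInf n}
    (hx : x ∈ Submodule.span ℝ (d hmn '' GamLE n N)) (γ : Gam n) :
    pairing n (projE m γ.1 γ.2 0 N) x = pairing n (eStar γ) x := by
  induction hx using Submodule.span_induction with
  | mem x hx =>
    obtain ⟨ξ, hξ, rfl⟩ := hx
    rw [pairing_projE, if_pos ⟨ξ.2.one_le_rank, hξ⟩, pairing_eStar]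
    rfl
  | zero => simp
  | add x y _ _ hx hy => rw [map_add, map_add, hx, hy]
  | smul a x _ hx => rw [map_smul, map_smul, hx]

/-- On the span `P*_{(s,N]} e*_γ` acts as `e*_γ - P*_{(0,s]} e*_γ`, whence `1 + 2 = 3`. -/
theorem abs_pairing_projE_le (hmn : Admissible m n) {N : ℕ} {x : LInf n}
    (hx : x ∈ Submodule.span ℝ (d hmn '' GamLE n N)) (γ : Node) (h : IsNode n γ) (s : ℕ) :
    |pairing n (projE m γ h s N) x| ≤ 3 * ‖x‖ := by
  rcases le_total N s with hs | hs
  · rw [projE_eq_zero_of_le m γ h hs]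
    simp
  · rw [projE_eq_sub, max_eq_right hs, map_sub, sub_apply,
      pairing_projE_zero_eq hmn hx ⟨γ, h⟩]
    refine (abs_sub _ _).trans ?_
    linarith [abs_pairing_eStar_le ⟨γ, h⟩ x, abs_pairing_projE_zero_le hmn x γ h s]

end Projections

/-! ### Approximation by nodes of bounded rank -/

section Approximation

variable {m n : ℕ → ℕ}

/-- `ApproxBy hmn N C f g`: on `⟨d_ξ : ξ ∈ Γ_N⟩` the functionals `f s` and `g s` differ in norm
by at most `C`, for all `s`. -/
def ApproxBy (hmn : Admissible m n) (N : ℕ) (C : ℝ) (f g : ℕ → (Gam n →₀ ℝ)) : Prop :=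
  ∀ s, ∀ x ∈ Submodule.span ℝ (d hmn '' GamLE n N),
    |pairing n (f s) x - pairing n (g s) x| ≤ C * ‖x‖

theorem ApproxBy.refl (hmn : Admissible m n) (N : ℕ) {C : ℝ} (hC : 0 ≤ C)
    (f : ℕ → (Gam n →₀ ℝ)) : ApproxBy hmn N C f f := by
  intro s x _
  rw [sub_self, abs_zero]
  positivity

theorem ApproxBy.mono {hmn : Admissible m n} {N : ℕ} {C C' : ℝ} {f g : ℕ → (Gam n →₀ ℝ)}
    (h : ApproxBy hmn N C f g) (hC : C ≤ C') : ApproxBy hmn N C' f g := fun s x hx =>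
  (h s x hx).trans (mul_le_mul_of_nonneg_right hC (norm_nonneg x))

theorem ApproxBy.smul {hmn : Admissible m n} {N : ℕ} {C D a : ℝ} {f g : ℕ → (Gam n →₀ ℝ)}
    (h : ApproxBy hmn N C f g) (ha : |a| ≤ D) :
    ApproxBy hmn N (D * C) (fun s => a • f s) (fun s => a • g s) := by
  intro s x hx
  simp only [map_smul, smul_apply, smul_eq_mul]
  rw [← mul_sub, abs_mul, mul_assoc]
  exact mul_le_mul ha (h s x hx) (abs_nonneg _) ((abs_nonneg a).trans ha)

theorem ApproxBy.add_left {hmn : Admissible m n} {N : ℕ} {C : ℝ} {f g : ℕ → (Gam n →₀ ℝ)}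
    (h : ApproxBy hmn N C f g) (k : ℕ → (Gam n →₀ ℝ)) :
    ApproxBy hmn N C (fun s => k s + f s) (fun s => k s + g s) := by
  intro s x hx
  simpa only [map_add, add_apply, add_sub_add_left_eq_sub] using h s x hx

theorem ApproxBy.comp {hmn : Admissible m n} {N : ℕ} {C : ℝ} {f g : ℕ → (Gam n →₀ ℝ)}
    (h : ApproxBy hmn N C f g) (k : ℕ → ℕ) :
    ApproxBy hmn N C (fun s => f (k s)) (fun s => g (k s)) := fun s x hx => h (k s) x hx

theorem approxBy_projE_zero (hmn : Admissible m n) (N : ℕ) (γ : Node) (h : IsNode n γ) :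
    ApproxBy hmn N 3 (fun s => projE m γ h s N) 0 := by
  intro s x hx
  simpa using abs_pairing_projE_le hmn hx γ h s

/-- A node whose projections are small can be approximated by a node with a small weight. -/
theorem exists_approxBy_of_small (hmn : Admissible m n) {N i : ℕ} (hN : 1 ≤ N) (hi : 1 ≤ i)
    {f : ℕ → (Gam n →₀ ℝ)} (hf : ApproxBy hmn N (3 / 4 * ((4 : ℝ) ^ i)⁻¹) f 0) :
    ∃ γ' : Gam n, γ'.1.rank ≤ N + i ∧
      ApproxBy hmn N ((4 : ℝ) ^ i)⁻¹ f fun s => projE m γ'.1 γ'.2 s N := by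
  -- Rank `N + i` admits the weight index `N + i ≥ i + 1`, so this node costs only the remaining
  -- quarter of `4^{-i}`.
  have hnode : IsNode n (.init (N + i - 1) (N + i) 1 .one) :=
    .init (by omega) (by omega) .one (by simp only [Node.rank]; omega)
  refine ⟨⟨_, hnode⟩, by simp only [Node.rank]; omega, fun s x hx => ?_⟩
  have h1 := hf s x hx
  simp only [Pi.zero_apply, map_zero, zero_apply, sub_zero] at h1
  have hpos : 0 ≤ ((4 : ℝ) ^ i)⁻¹ := by positivity
  refine (abs_sub _ _).trans ?_
  have h2 : |pairing n (projE m _ hnode s N) x| ≤ 1 / 4 * ((4 : ℝ) ^ i)⁻¹ * ‖x‖ := by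
    rw [projE_init m hnode s (by omega)]
    simp only [map_smul, smul_apply, smul_eq_mul, abs_mul]
    rcases Nat.eq_zero_or_pos s with rfl | hs
    · rw [pairing_projE_zero_eq hmn hx ⟨.one, .one⟩]
      have h3 : |sw m (N + i) 1| ≤ 1 / 4 * ((4 : ℝ) ^ i)⁻¹ := by
        refine (hmn.abs_sw_le_pow (k := i + 1) (by omega) (by omega) 1).trans_eq ?_
        rw [pow_succ, mul_inv]; ring
      exact mul_le_mul h3 (abs_pairing_eStar_le _ x) (abs_nonneg _) (by positivity)
    · rw [projE_eq_zero_of_rank_le m .one _ N hs]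
      simp only [map_zero, zero_apply, abs_zero, mul_zero]
      positivity
  linarith

/-- Every node is approximated up to `1` by a node of rank at most `N`, or else it is small. -/
theorem exists_approxBy_one (hmn : Admissible m n) (N : ℕ) (hN : 1 ≤ N) (γ : Node)
    (h : IsNode n γ) :
    (∃ γ' : Gam n, γ'.1.rank ≤ N ∧
      ApproxBy hmn N 1 (fun s => projE m γ h s N) fun s => projE m γ'.1 γ'.2 s N) ∨
    ApproxBy hmn N (3 / 4) (fun s => projE m γ h s N) 0 := by
  by_cases hr : γ.rank ≤ N
  · exact .inl ⟨⟨γ, h⟩, hr, .refl hmn N zero_le_one _⟩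
  induction γ with
  | one => exact absurd hN hr
  | init r j ε η ih =>
    have hj : 1 ≤ j := by cases h; assumption
    have hrN : N ≤ r := by simp only [Node.rank] at hr; omega
    right
    simp only [projE_init m h _ hrN]
    convert (approxBy_projE_zero hmn N η h.of_init).smul (hmn.abs_sw_le_quarter hj ε) using 1
    · norm_num
    · simp; rfl
  | ext r ξ j ε η ih1 ih2 =>
    have hj : 1 ≤ j := by cases h; assumption
    have hrN : N ≤ r := by simp only [Node.rank] at hr; omega
    simp only [projE_ext m h _ hrN]
    by_cases hξ : ξ.rank ≤ N
    -- Dropping the term of `η` altogether costs `(1/4) · 3 ≤ 1`.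
    · refine .inl ⟨⟨ξ, h.of_ext_left⟩, hξ, ?_⟩
      have h1 := (((approxBy_projE_zero hmn N η h.of_ext_right).smul
        (hmn.abs_sw_le_quarter hj ε)).comp (max · ξ.rank)).add_left
        fun s => projE m ξ h.of_ext_left s N
      simp only [Pi.zero_apply, smul_zero, add_zero] at h1
      exact h1.mono (by norm_num)
    · have h0 : ∀ s, projE m η h.of_ext_right (max s ξ.rank) N = 0 := fun s =>
        projE_eq_zero_of_le m η _ (by omega)
      simp only [h0, smul_zero, add_zero]
      exact ih1 h.of_ext_left hξ

/-- Each replacement of `η` gains a factor `1/4` and uses one unit of rank. Uniformity in `s` is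
what lets the hypothesis for `η` be applied at `max s ξ.rank`. -/
theorem exists_approxBy (hmn : Admissible m n) (N : ℕ) (hN : 1 ≤ N) (γ : Node)
    (h : IsNode n γ) (i : ℕ) (hi : 1 ≤ i) :
    ∃ γ' : Gam n, γ'.1.rank ≤ N + i ∧
      ApproxBy hmn N ((4 : ℝ) ^ i)⁻¹ (fun s => projE m γ h s N)
        fun s => projE m γ'.1 γ'.2 s N := by
  induction γ generalizing i with
  | one =>
    exact ⟨⟨.one, h⟩, by simp only [Node.rank]; omega, .refl hmn N (by positivity) _⟩
  | init r j ε η ih =>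
    by_cases hr : r + 1 ≤ N + i
    · exact ⟨⟨_, h⟩, hr, .refl hmn N (by positivity) _⟩
    have hj : 1 ≤ j := by cases h; assumption
    have hrN : N ≤ r := by omega
    simp only [projE_init m h _ hrN]
    -- Here `j ≥ i + 2` because `N ≥ 1`, so the whole functional is at most `3 · 4^{-(i+2)}`.
    by_cases hji : N + i < j
    · refine exists_approxBy_of_small hmn hN hi ?_
      have h1 := (approxBy_projE_zero hmn N η h.of_init).smul
        (hmn.abs_sw_le_pow hj (by omega : i + 2 ≤ j) ε)
      simp only [Pi.zero_apply, smul_zero] at h1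
      refine ApproxBy.mono h1 ?_
      have : 0 ≤ ((4 : ℝ) ^ i)⁻¹ := by positivity
      rw [pow_add, mul_inv]
      linarith
    have key : ∀ η' : Gam n, η'.1.rank ≤ N + i - 1 →
        ApproxBy hmn N ((4 : ℝ) ^ (i - 1))⁻¹ (fun s => projE m η h.of_init s N)
          (fun s => projE m η'.1 η'.2 s N) →
        ∃ γ' : Gam n, γ'.1.rank ≤ N + i ∧
          ApproxBy hmn N ((4 : ℝ) ^ i)⁻¹ (fun s => sw m j ε • projE m η h.of_init s N)
            fun s => projE m γ'.1 γ'.2 s N := by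
      intro η' hη' happ
      have hnode : IsNode n (.init (N + i - 1) j ε η'.1) :=
        .init hj (by omega) η'.2 hη'
      refine ⟨⟨_, hnode⟩, by simp only [Node.rank]; omega, ?_⟩
      simp only [projE_init m hnode _ (by omega : N ≤ N + i - 1)]
      refine (happ.smul (hmn.abs_sw_le_quarter hj ε)).mono (le_of_eq ?_)
      obtain ⟨k, rfl⟩ := Nat.exists_eq_add_of_le' hi
      rw [Nat.add_sub_cancel, pow_succ, mul_inv]; ring
    -- For `i = 1` the node `η'` would need rank at most `N` and accuracy 1. If none is provided,
    -- `η` is bounded by `3/4`, and the factor `1/4` brings this exactly to the threshold for small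
    -- functionals.
    rcases hi.eq_or_lt with rfl | hi2
    · rcases exists_approxBy_one hmn N hN η h.of_init with ⟨η', hη', happ⟩ | hsmall
      · exact key η' hη' (by simpa using happ)
      · refine exists_approxBy_of_small hmn hN le_rfl ?_
        have h1 := hsmall.smul (hmn.abs_sw_le_quarter hj ε)
        simp only [Pi.zero_apply, smul_zero] at h1
        exact ApproxBy.mono h1 (by norm_num)
    · obtain ⟨η', hη', happ⟩ := ih h.of_init (i - 1) (by omega)
      exact key η' (by omega) happ
  | ext r ξ j ε η ih1 ih2 =>
    by_cases hr : r + 1 ≤ N + i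
    · exact ⟨⟨_, h⟩, hr, .refl hmn N (by positivity) _⟩
    have hj : 1 ≤ j := by cases h; assumption
    have hrN : N ≤ r := by omega
    simp only [projE_ext m h _ hrN]
    -- The term of `η` lives on ranks above `N`, so `γ` and `ξ` are indistinguishable here.
    by_cases hξ : N ≤ ξ.rank
    · have h0 : ∀ s, projE m η h.of_ext_right (max s ξ.rank) N = 0 := fun s =>
        projE_eq_zero_of_le m η _ (by omega)
      simp only [h0, smul_zero, add_zero]
      exact ih1 h.of_ext_left i hi
    have step : ∀ g : ℕ → (Gam n →₀ ℝ),
        ApproxBy hmn N ((4 : ℝ) ^ (i - 1))⁻¹ (fun s => projE m η h.of_ext_right s N) g →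
        ApproxBy hmn N ((4 : ℝ) ^ i)⁻¹
          (fun s => projE m ξ h.of_ext_left s N
            + sw m j ε • projE m η h.of_ext_right (max s ξ.rank) N)
          (fun s => projE m ξ h.of_ext_left s N + sw m j ε • g (max s ξ.rank)) := by
      intro g hg
      have h1 := ((hg.smul (hmn.abs_sw_le_quarter hj ε)).comp (max · ξ.rank)).add_left
        fun s => projE m ξ h.of_ext_left s N
      refine ApproxBy.mono h1 (le_of_eq ?_)
      obtain ⟨k, rfl⟩ := Nat.exists_eq_add_of_le' hi
      rw [Nat.add_sub_cancel, pow_succ, mul_inv]; ring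
    have key : ∀ η' : Gam n, η'.1.rank ≤ N + i - 1 →
        ApproxBy hmn N ((4 : ℝ) ^ (i - 1))⁻¹ (fun s => projE m η h.of_ext_right s N)
          (fun s => projE m η'.1 η'.2 s N) →
        ∃ γ' : Gam n, γ'.1.rank ≤ N + i ∧
          ApproxBy hmn N ((4 : ℝ) ^ i)⁻¹ (fun s => projE m ξ h.of_ext_left s N
            + sw m j ε • projE m η h.of_ext_right (max s ξ.rank) N)
            fun s => projE m γ'.1 γ'.2 s N := by
      intro η' hη' happ
      have h1 := step _ happ
      -- Such an `η'` may not extend `ξ`, but its projection past `rank ξ` vanishes, so `ξ` alone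
      -- serves. Otherwise the conditions on weight and age concern only `ξ` and `j` and carry over
      -- from `γ`.
      by_cases hη'ξ : η'.1.rank ≤ ξ.rank
      · refine ⟨⟨ξ, h.of_ext_left⟩, by dsimp only; omega, ?_⟩
        have h0 : ∀ s, projE m η'.1 η'.2 (max s ξ.rank) N = 0 := fun s =>
          projE_eq_zero_of_rank_le m _ _ N (hη'ξ.trans (le_max_right _ _))
        simpa only [h0, smul_zero, add_zero] using h1
      · have hnode : IsNode n (.ext (N + i - 1) ξ j ε η'.1) := by
          cases h with
          | ext hξn h1r hrk hj' hjr hw ha hη hrr hrη =>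
            exact .ext hξn h1r (by omega) hj' hjr hw ha η'.2 (by omega) hη'
        refine ⟨⟨_, hnode⟩, by simp only [Node.rank]; omega, ?_⟩
        simpa only [projE_ext m hnode _ (by omega : N ≤ N + i - 1)] using h1
    rcases hi.eq_or_lt with rfl | hi2
    · rcases exists_approxBy_one hmn N hN η h.of_ext_right with ⟨η', hη', happ⟩ | hsmall
      · exact key η' hη' (by simpa using happ)
      -- A small `η` is replaced by 0, which leaves `ξ`.
      · refine ⟨⟨ξ, h.of_ext_left⟩, by dsimp only; omega, ?_⟩
        have h1 := step 0 (hsmall.mono (by norm_num))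
        simpa only [Pi.zero_apply, smul_zero, add_zero] using h1
    · obtain ⟨η', hη', happ⟩ := ih2 h.of_ext_right (i - 1) (by omega)
      exact key η' (by omega) happ

end Approximation

end BmT

end

theorem mainTheorem3 (m n : ℕ → ℕ) (hmn : BmT.Admissible m n) (γ : BmT.Gam n) (K N : ℕ)
    (hK : K ≤ BmT.minRng m (BmT.eStar γ)) (hN : BmT.minRng m (BmT.eStar γ) ≤ N)
    (i : ℕ) (hi : 1 ≤ i) :
    ∃ γ' ∈ BmT.GamLE n (N + i),
      K ≤ BmT.minRng m (BmT.eStar γ') ∧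
      ‖(BmT.pairing n (BmT.eStar γ - BmT.eStar γ')).comp
          (Submodule.span ℝ (BmT.d hmn '' BmT.GamLE n N)).subtypeL‖ ≤ ((4 : ℝ) ^ i)⁻¹ := by
  have hγ := BmT.minRng_eStar hmn γ
  obtain ⟨γ', hγ', happ⟩ := BmT.exists_approxBy hmn N (hγ ▸ hN) γ.1 γ.2 i hi
  refine ⟨γ', hγ', by rwa [BmT.minRng_eStar hmn γ', ← hγ], ?_⟩
  refine ContinuousLinearMap.opNorm_le_bound _ (by positivity) fun x => ?_
  -- At `s = 0` the projections act on the span as the evaluations themselves.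
  have h1 := happ 0 x x.2
  rw [BmT.pairing_projE_zero_eq hmn x.2 γ, BmT.pairing_projE_zero_eq hmn x.2 γ'] at h1
  simpa using h1
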